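/- There is a computable function $\gamma:\mathbb N\to\mathbb N$ with the following property. Let $n,m\in\mathbb N$ and let $H$ be a group generated by $n$ elements (not necessarily distinct). Let $N_1,\dots,N_m$ be normal subgroups of $H$ such that, for each $i=1,\dots,m$, there is a surjective homomorphism from $H/N_i$ onto the free group $\mathbb F_2$ of rank $2$, and such that the product $N_iN_j$ has finite index in $H$ for all $1\le i<j\le m$. Then $m\le\gamma(n)$. -/

import Mathlib

/-! ### Polynomial functions on a group -/

section Polynomial

variable (k : Type*) [Field k] {G : Type*} [Group G]

/-! Each N_i lies in the kernel of a surjection f_i from H to F_2. Let F_2 act by translation on its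
mod 2 polynomial functions of degree at most 4n, a finite set. If i < j and the generators of H act
equally through f_i and f_j, then f_i and f_j agree modulo the kernel K of this action. A section of
f_j shows that ker f_j is normally generated by n elements, and f_i sends these into K. So f_i(ker
f_j), of finite index, lies in the normal closure R of n elements of K.

This contradicts Golod–Shafarevich (`finrank_polyInvFun_succ`, `not_finiteIndex_normalClosure`): if
R had finite index, the dimensions of R-invariant polynomial functions would be bounded by that
index, yet the inequality makes them unbounded. Hence m is at most the number of possible actions
(`injective_polyAction_comp`). -/

/-- Right translation of functions on a group. -/
def rightTranslate (g : G) : (G → k) →ₗ[k] (G → k) :=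
  LinearMap.funLeft k k (· * g)

variable {k}

@[simp]
lemma rightTranslate_apply (g : G) (f : G → k) (y : G) : rightTranslate k g f y = f (y * g) := rfl

lemma rightTranslate_mul (g h : G) (f : G → k) :
    rightTranslate k (g * h) f = rightTranslate k g (rightTranslate k h f) := by
  ext y; simp [mul_assoc]

@[simp]
lemma rightTranslate_one (f : G → k) : rightTranslate k 1 f = f := by
  ext y; simp

variable (k G) in
/-- The functions killed by every product of `s` differences `g - 1`, that is,
the polynomial functions of degree less than `s`. -/
def polyFun : ℕ → Submodule k (G → k)
  | 0 => ⊥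
  | s + 1 => ⨅ g : G, (polyFun s).comap (rightTranslate k g - LinearMap.id)

@[simp]
lemma mem_polyFun_zero {f : G → k} : f ∈ polyFun k G 0 ↔ f = 0 := Iff.rfl

lemma mem_polyFun_succ {s : ℕ} {f : G → k} :
    f ∈ polyFun k G (s + 1) ↔ ∀ g, rightTranslate k g f - f ∈ polyFun k G s := by
  simp [polyFun]

lemma polyFun_le_succ (s : ℕ) : polyFun k G s ≤ polyFun k G (s + 1) := by
  induction s with
  | zero => exact bot_le
  | succ s ih =>
    intro f hf
    rw [mem_polyFun_succ] at hf ⊢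
    exact fun g => ih (hf g)

lemma rightTranslate_mem_polyFun {s : ℕ} {f : G → k} (hf : f ∈ polyFun k G s) (g : G) :
    rightTranslate k g f ∈ polyFun k G s := by
  have h := mem_polyFun_succ.1 (polyFun_le_succ s hf) g
  simpa using add_mem h hf

/-- Differences of the matrix coefficient of f are matrix coefficients of differences of f; after d
of them only degree less than s is left, which l kills. -/
lemma orbitMap_mem_polyFun {s : ℕ} (l : (G → k) →ₗ[k] k)
    (hl : ∀ f ∈ polyFun k G s, l f = 0) (d : ℕ) {f : G → k} (hf : f ∈ polyFun k G (s + d)) :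
    (fun g => l (rightTranslate k g f)) ∈ polyFun k G d := by
  induction d generalizing f with
  | zero =>
    rw [mem_polyFun_zero]
    ext g
    exact hl _ (rightTranslate_mem_polyFun hf g)
  | succ d ih =>
    rw [mem_polyFun_succ]
    intro x
    convert ih (mem_polyFun_succ.1 (show f ∈ polyFun k G (s + d + 1) from hf) x) using 1
    ext g
    simp [rightTranslate_mul]

/-- An element acting trivially on the polynomial functions of degree less than `d` lowers the
degree of every polynomial function by `d`. -/
lemma rightTranslate_sub_mem_polyFun {d : ℕ} {r : G}
    (hr : ∀ f ∈ polyFun k G d, rightTranslate k r f = f) (s : ℕ) {f : G → k}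
    (hf : f ∈ polyFun k G (s + d)) : rightTranslate k r f - f ∈ polyFun k G s := by
  by_contra h
  -- Duality: l separates the difference from lower degree, but its matrix coefficient at f has
  -- degree less than d, so r fixes it; evaluate at 1.
  obtain ⟨l, hl, hle⟩ := Submodule.exists_le_ker_of_notMem h
  refine hl ?_
  have h1 := congrFun (hr _ (orbitMap_mem_polyFun l (fun f hf => hle hf) d hf)) 1
  simp only [rightTranslate_apply, one_mul, rightTranslate_one] at h1
  rw [map_sub, h1, sub_self]

variable (k) in
/-- The functions invariant under right translation by a subgroup. -/
def invFun (R : Subgroup G) : Submodule k (G → k) :=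
  ⨅ r : R, LinearMap.ker (rightTranslate k (r : G) - LinearMap.id)

lemma mem_invFun {R : Subgroup G} {f : G → k} :
    f ∈ invFun k R ↔ ∀ r ∈ R, rightTranslate k r f = f := by
  simp [invFun, sub_eq_zero]

lemma rightTranslate_mem_invFun {R : Subgroup G} [hR : R.Normal] {f : G → k}
    (hf : f ∈ invFun k R) (g : G) : rightTranslate k g f ∈ invFun k R := by
  rw [mem_invFun] at hf ⊢
  intro r hr
  have h := hf (g⁻¹ * r * g) (by simpa using hR.conj_mem r hr g⁻¹)
  calc _ = rightTranslate k g (rightTranslate k (g⁻¹ * r * g) f) := by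
        simp only [← rightTranslate_mul]; congr 1; group
    _ = _ := by rw [h]

lemma invFun_le_range (R : Subgroup G) :
    invFun k R ≤ LinearMap.range (LinearMap.funLeft k k (QuotientGroup.mk : G → G ⧸ R)) := by
  intro f hf
  rw [mem_invFun] at hf
  refine ⟨fun q => f q.out, ?_⟩
  ext g
  obtain ⟨h, hh⟩ := QuotientGroup.mk_out_eq_mul R g
  have := congrFun (hf h h.2) g
  simpa [LinearMap.funLeft_apply, hh] using this

instance (R : Subgroup G) [R.FiniteIndex] : FiniteDimensional k (invFun k R) := by
  have := Fintype.ofFinite (G ⧸ R)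
  exact Submodule.finiteDimensional_of_le (invFun_le_range R)

variable (k) in
/-- The polynomial functions of degree less than `s` which are invariant under `R`. -/
def polyInvFun (R : Subgroup G) (s : ℕ) : Submodule k (G → k) := polyFun k G s ⊓ invFun k R

instance (R : Subgroup G) [R.FiniteIndex] (s : ℕ) : FiniteDimensional k (polyInvFun k R s) :=
  Submodule.finiteDimensional_of_le (inf_le_right : _ ≤ invFun k R)

lemma finrank_polyInvFun_zero (R : Subgroup G) :
    Module.finrank k (polyInvFun k R 0) = 0 := by
  have h : polyInvFun k R 0 = ⊥ := bot_inf_eq _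
  rw [h, finrank_bot]

lemma finrank_polyInvFun_le_index (R : Subgroup G) [R.FiniteIndex] (s : ℕ) :
    Module.finrank k (polyInvFun k R s) ≤ R.index := by
  have := Fintype.ofFinite (G ⧸ R)
  calc _ ≤ _ := Submodule.finrank_mono (inf_le_right.trans (invFun_le_range R))
    _ ≤ _ := LinearMap.finrank_range_le _
    _ = R.index := by rw [Module.finrank_pi, Subgroup.index, Nat.card_eq_fintype_card]

/-- As translates of f differ from f by invariant functions, a relator fixing f fixes its translates
too, so its conjugates fix f. -/
lemma mem_invFun_normalClosure {S : Set G} {f : G → k}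
    (hS : ∀ r ∈ S, rightTranslate k r f = f)
    (hf : ∀ g, rightTranslate k g f - f ∈ invFun k (Subgroup.normalClosure S)) :
    f ∈ invFun k (Subgroup.normalClosure S) := by
  rw [mem_invFun]
  intro r hr
  rw [Subgroup.normalClosure] at hr
  induction hr using Subgroup.closure_induction with
  | mem x hx =>
    obtain ⟨r, hr, hrx⟩ := Group.mem_conjugatesOfSet_iff.1 hx
    obtain ⟨g, rfl⟩ := isConj_iff.1 hrx
    have h1 := mem_invFun.1 (hf g⁻¹) r (Subgroup.subset_normalClosure hr)
    rw [map_sub, hS r hr, sub_left_inj] at h1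
    rw [mul_assoc, rightTranslate_mul, rightTranslate_mul, h1, ← rightTranslate_mul]
    simp
  | one => simp
  | mul x y _ _ hx hy => rw [rightTranslate_mul, hy, hx]
  | inv x _ hx =>
    conv_lhs => rw [← hx, ← rightTranslate_mul]
    simp

end Polynomial

/-! ### Free groups -/

section Free

variable (k : Type*) [Field k] (α : Type*)

/-- The map sending a function on a free group to its differences along the generators and its
value at `1`. -/
def freeDiff : (FreeGroup α → k) →ₗ[k] (α → FreeGroup α → k) × k :=
  (LinearMap.pi fun a => rightTranslate k (FreeGroup.of a) - LinearMap.id).prod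
    (LinearMap.proj 1)

variable {k α}

lemma freeDiff_apply (f : FreeGroup α → k) :
    freeDiff k α f = (fun a => rightTranslate k (FreeGroup.of a) f - f, f 1) := rfl

lemma rightTranslate_sub_mem_of_generators {B : Submodule k (FreeGroup α → k)}
    (hB : ∀ f ∈ B, ∀ g, rightTranslate k g f ∈ B) {f : FreeGroup α → k}
    (hf : ∀ a, rightTranslate k (FreeGroup.of a) f - f ∈ B) (g : FreeGroup α) :
    rightTranslate k g f - f ∈ B := by
  have hg : g ∈ Subgroup.closure (Set.range (FreeGroup.of : α → FreeGroup α)) := by simp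
  induction hg using Subgroup.closure_induction with
  | mem x hx => obtain ⟨a, rfl⟩ := hx; exact hf a
  | one => simp
  | mul x y _ _ hx hy =>
    have := add_mem (hB _ hy x) hx
    rwa [map_sub, ← rightTranslate_mul, sub_add_sub_cancel] at this
  | inv x _ hx =>
    have := neg_mem (hB _ hx x⁻¹)
    rwa [map_sub, ← rightTranslate_mul, neg_sub, inv_mul_cancel, rightTranslate_one] at this

lemma freeDiff_injective : Function.Injective (freeDiff k α) := by
  rw [← LinearMap.ker_eq_bot, LinearMap.ker_eq_bot']
  intro f hf
  rw [freeDiff_apply, Prod.mk_eq_zero] at hf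
  ext g
  have h := rightTranslate_sub_mem_of_generators (B := ⊥) (f := f) (by simp +contextual)
    (fun a => congrFun hf.1 a) g
  have h1 := congrFun h 1
  simp only [Pi.sub_apply, rightTranslate_apply, one_mul, hf.2, sub_zero] at h1
  exact h1

/-- The affine permutation `w ↦ g w + u` of the functions on a group. -/
def affineTranslate {G : Type*} [Group G] (g : G) (u : G → k) : Equiv.Perm (G → k) where
  toFun w := rightTranslate k g w + u
  invFun w := rightTranslate k g⁻¹ (w - u)
  left_inv w := by simp [← rightTranslate_mul]
  right_inv w := by simp [← rightTranslate_mul]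

lemma affineTranslate_apply {G : Type*} [Group G] (g : G) (u w : G → k) :
    affineTranslate g u w = rightTranslate k g w + u := rfl

/-- The linear part being translation, the images of 0 form a cocycle with arbitrary values on the
generators; its value at 1 integrates prescribed differences. -/
lemma lift_affineTranslate_apply (u : α → FreeGroup α → k) (g : FreeGroup α)
    (w : FreeGroup α → k) :
    FreeGroup.lift (fun a => affineTranslate (FreeGroup.of a) (u a)) g w =
      rightTranslate k g w +
        FreeGroup.lift (fun a => affineTranslate (FreeGroup.of a) (u a)) g 0 := by
  set L := FreeGroup.lift (fun a => affineTranslate (FreeGroup.of a) (u a)) with hL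
  have hg : g ∈ Subgroup.closure (Set.range (FreeGroup.of : α → FreeGroup α)) := by simp
  induction hg using Subgroup.closure_induction generalizing w with
  | mem x hx => obtain ⟨a, rfl⟩ := hx; simp [hL, affineTranslate_apply]
  | one => simp
  | mul x y _ _ hx hy =>
    rw [map_mul, Equiv.Perm.mul_apply, hy, hx, Equiv.Perm.mul_apply, hx (L y 0),
      rightTranslate_mul, map_add, add_assoc]
  | inv x _ hx =>
    have key : ∀ w, L x⁻¹ w = rightTranslate k x⁻¹ w - rightTranslate k x⁻¹ (L x 0) := by
      intro w
      have h := hx (L x⁻¹ w)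
      rw [← Equiv.Perm.mul_apply, ← map_mul, mul_inv_cancel, map_one, Equiv.Perm.one_apply] at h
      conv_rhs => rw [h, map_add, ← rightTranslate_mul]
      simp
    rw [key, key 0]
    simp [sub_eq_add_neg]

lemma freeDiff_surjective : Function.Surjective (freeDiff k α) := by
  rintro ⟨u, c⟩
  set L := FreeGroup.lift (fun a => affineTranslate (FreeGroup.of a) (u a)) with hL
  refine ⟨fun g => L g 0 1 + c, ?_⟩
  rw [freeDiff_apply, Prod.mk.injEq]
  refine ⟨?_, by simp⟩
  ext a g
  change L (g * FreeGroup.of a) 0 1 + c - (L g 0 1 + c) = u a g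
  have h : L (g * FreeGroup.of a) 0 = rightTranslate k g (u a) + L g 0 := by
    rw [map_mul, Equiv.Perm.mul_apply, hL, lift_affineTranslate_apply]
    simp [affineTranslate_apply]
  simp only [h, Pi.add_apply, rightTranslate_apply, one_mul]
  ring

variable (k α) in
/-- A function on a free group is determined by its differences along the generators, which are
arbitrary, and its value at `1`. -/
noncomputable def freeDiffEquiv : (FreeGroup α → k) ≃ₗ[k] (α → FreeGroup α → k) × k :=
  LinearEquiv.ofBijective (freeDiff k α) ⟨freeDiff_injective, freeDiff_surjective⟩

lemma rightTranslate_of_freeDiffEquiv_symm (p : (α → FreeGroup α → k) × k) (a : α) :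
    rightTranslate k (FreeGroup.of a) ((freeDiffEquiv k α).symm p) -
      (freeDiffEquiv k α).symm p = p.1 a :=
  congrFun (congrArg Prod.fst ((freeDiffEquiv k α).apply_symm_apply p)) a

variable [Fintype α]

lemma finite_polyFun [Finite k] (s : ℕ) : Finite (polyFun k (FreeGroup α) s) := by
  induction s with
  | zero => exact inferInstanceAs (Finite (⊥ : Submodule k (FreeGroup α → k)))
  | succ s ih =>
    refine Finite.of_injective (β := (α → polyFun k (FreeGroup α) s) × k)
      (fun f => (fun a => ⟨_, mem_polyFun_succ.1 f.2 (FreeGroup.of a)⟩, f.1 1)) ?_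
    intro f f' h
    refine Subtype.ext (freeDiff_injective ?_)
    simp only [Prod.mk.injEq, freeDiff_apply] at h ⊢
    exact ⟨funext fun a => congrArg Subtype.val (congrFun h.1 a), h.2⟩

lemma card_polyFun_succ_le [Finite k] (s : ℕ) :
    Nat.card (polyFun k (FreeGroup α) (s + 1)) ≤
      Nat.card (polyFun k (FreeGroup α) s) ^ Fintype.card α * Nat.card k := by
  have := finite_polyFun (k := k) (α := α) s
  refine (Nat.card_le_card_of_injective (β := (α → polyFun k (FreeGroup α) s) × k)
      (fun f => (fun a => ⟨_, mem_polyFun_succ.1 f.2 (FreeGroup.of a)⟩, f.1 1)) ?_).trans_eq ?_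
  · intro f f' h
    refine Subtype.ext (freeDiff_injective ?_)
    simp only [Prod.mk.injEq, freeDiff_apply] at h ⊢
    exact ⟨funext fun a => congrArg Subtype.val (congrFun h.1 a), h.2⟩
  · rw [Nat.card_prod, Nat.card_fun, Nat.card_eq_fintype_card (α := α)]

/-- The Golod–Shafarevich inequality. -/
lemma finrank_polyInvFun_succ {ι : Type*} [Fintype ι] {d : ℕ} (r : ι → FreeGroup α)
    (hr : ∀ i, ∀ f ∈ polyFun k (FreeGroup α) d, rightTranslate k (r i) f = f)
    [(Subgroup.normalClosure (Set.range r)).FiniteIndex] (s t : ℕ) (hst : s + 1 ≤ t + d) :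
    Fintype.card α * Module.finrank k (polyInvFun k (Subgroup.normalClosure (Set.range r)) s) + 1 ≤
      Module.finrank k (polyInvFun k (Subgroup.normalClosure (Set.range r)) (s + 1)) +
      Fintype.card ι *
        Module.finrank k (polyInvFun k (Subgroup.normalClosure (Set.range r)) t) := by
  set R := Subgroup.normalClosure (Set.range r) with hR
  set B := polyInvFun k R s with hB
  have hBstable : ∀ f ∈ B, ∀ g, rightTranslate k g f ∈ B := fun f hf g =>
    ⟨rightTranslate_mem_polyFun hf.1 g, rightTranslate_mem_invFun hf.2 g⟩
  -- J integrates generator differences chosen in B, with a free constant term.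
  let J : (α → B) × k →ₗ[k] (FreeGroup α → k) :=
    (freeDiffEquiv k α).symm.toLinearMap ∘ₗ
      ((LinearMap.pi fun a => B.subtype ∘ₗ LinearMap.proj a).prodMap LinearMap.id)
  have hJdiff : ∀ p g, rightTranslate k g (J p) - J p ∈ B := fun p =>
    rightTranslate_sub_mem_of_generators hBstable fun a => by
      simp only [J, LinearMap.comp_apply, LinearEquiv.coe_coe,
        rightTranslate_of_freeDiffEquiv_symm]
      exact (p.1 a).2
  have hJpoly : ∀ p, J p ∈ polyFun k (FreeGroup α) (s + 1) := fun p =>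
    mem_polyFun_succ.2 fun g => (hJdiff p g).1
  have hJinj : Function.Injective J := by
    refine (freeDiffEquiv k α).symm.injective.comp ?_
    rintro ⟨p, c⟩ ⟨p', c'⟩ h
    simp only [LinearMap.prodMap_apply, Prod.mk.injEq] at h ⊢
    exact ⟨funext fun a => Subtype.ext (congrFun h.1 a), h.2⟩
  have hmono : Monotone (polyFun k (FreeGroup α)) := monotone_nat_of_le_succ polyFun_le_succ
  -- D measures the failure of invariance under the relators. Being deep, they lower degree by d, so
  -- the obstruction has degree less than t. Rank–nullity for D gives the inequality.
  let D : (α → B) × k →ₗ[k] (ι → polyInvFun k R t) :=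
    LinearMap.pi fun i => LinearMap.codRestrict _
      ((rightTranslate k (r i) - LinearMap.id) ∘ₗ J) fun p =>
        ⟨rightTranslate_sub_mem_polyFun (hr i) t (hmono hst (hJpoly p)), (hJdiff p _).2⟩
  have hker : ∀ p ∈ LinearMap.ker D, J p ∈ polyInvFun k R (s + 1) := by
    intro p hp
    refine ⟨hJpoly p, mem_invFun_normalClosure ?_ fun g => (hJdiff p g).2⟩
    rintro _ ⟨i, rfl⟩
    exact sub_eq_zero.1 (congrArg Subtype.val (congrFun (LinearMap.mem_ker.1 hp) i))
  have h1 := LinearMap.finrank_range_add_finrank_ker D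
  have h2 : Module.finrank k (LinearMap.range D) ≤ _ := Submodule.finrank_le _
  have h3 : Module.finrank k (LinearMap.ker D) ≤ Module.finrank k (polyInvFun k R (s + 1)) :=
    LinearMap.finrank_le_finrank_of_injective (f := J.restrict hker) fun x y h =>
      Subtype.ext (hJinj (congrArg Subtype.val h))
  rw [Module.finrank_pi_fintype] at h2
  rw [Module.finrank_prod, Module.finrank_pi_fintype, Module.finrank_self] at h1
  simp only [Finset.sum_const, Finset.card_univ, smul_eq_mul] at h1 h2
  omega

end Free

/-! ### Cardinality and growth estimates -/

lemma card_polyFun_le (d : ℕ) :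
    Nat.card (polyFun (ZMod 2) (FreeGroup (Fin 2)) d) ≤ 2 ^ 2 ^ d := by
  -- The extra factor 2 absorbs the constant term: doubling c² · 2 gives (2c)².
  suffices h : Nat.card (polyFun (ZMod 2) (FreeGroup (Fin 2)) d) * 2 ≤ 2 ^ 2 ^ d by omega
  induction d with
  | zero => simp [polyFun]
  | succ d ih =>
    have h := card_polyFun_succ_le (k := ZMod 2) (α := Fin 2) d
    rw [Fintype.card_fin, Nat.card_zmod] at h
    calc _ ≤ (Nat.card (polyFun (ZMod 2) (FreeGroup (Fin 2)) d) * 2) ^ 2 := by nlinarith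
      _ ≤ (2 ^ 2 ^ d) ^ 2 := Nat.pow_le_pow_left ih 2
      _ = _ := by rw [← pow_mul, pow_succ]

lemma le_of_golodShafarevich_recursion {b : ℕ → ℕ} {n : ℕ} (h0 : b 0 = 0)
    (h : ∀ s t, s + 1 ≤ t + (4 * n + 1) → 2 * b s + 1 ≤ b (s + 1) + n * b t) (s : ℕ) :
    s ≤ b s := by
  have hn : 2 * n * 2 ^ (4 * n) ≤ 3 ^ (4 * n) := by
    have h1 : n + 1 ≤ 2 ^ n := Nat.lt_two_pow_self
    have h2 : (3 : ℕ) ^ (4 * n) = 81 ^ n := by rw [pow_mul]; norm_num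
    have h3 : (2 : ℕ) ^ (4 * n) = 16 ^ n := by rw [pow_mul]; norm_num
    have h4 : (2 : ℕ) ^ n * 2 ^ n * 16 ^ n ≤ 81 ^ n := by
      rw [← mul_pow, ← mul_pow]; exact Nat.pow_le_pow_left (by norm_num) n
    rw [h2, h3]
    refine le_trans (Nat.mul_le_mul_right _ ?_) h4
    nlinarith
  -- Growth by a factor 3/2 makes n b(s - 4n) at most b(s)/2, since 2n(2/3)^(4n) ≤ 1; this preserves
  -- the growth rate.
  have key : ∀ s, 3 * b s + 2 ≤ 2 * b (s + 1) := by
    intro s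
    induction s using Nat.strong_induction_on with
    | _ s ih =>
      have hdecay : ∀ j ≤ s, 3 ^ j * b (s - j) ≤ 2 ^ j * b s := by
        intro j
        induction j with
        | zero => simp
        | succ j ihj =>
          intro hj
          have e : s - j = s - (j + 1) + 1 := by omega
          have h1 := ih (s - (j + 1)) (by omega)
          rw [← e] at h1
          have h2 := ihj (by omega)
          calc 3 ^ (j + 1) * b (s - (j + 1)) = 3 ^ j * (3 * b (s - (j + 1))) := by ring
            _ ≤ 3 ^ j * (2 * b (s - j)) := Nat.mul_le_mul_left _ (by omega)
            _ = 2 * (3 ^ j * b (s - j)) := by ring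
            _ ≤ 2 * (2 ^ j * b s) := Nat.mul_le_mul_left _ h2
            _ = _ := by ring
      rcases le_total (4 * n) s with hs | hs
      · have h1 := h s (s - 4 * n) (by omega)
        have h2 : 2 * n * b (s - 4 * n) ≤ b s := by
          refine Nat.le_of_mul_le_mul_left ?_ (show 0 < 2 ^ (4 * n) by positivity)
          calc _ = 2 * n * 2 ^ (4 * n) * b (s - 4 * n) := by ring
            _ ≤ 3 ^ (4 * n) * b (s - 4 * n) := Nat.mul_le_mul_right _ hn
            _ ≤ _ := hdecay _ hs
        nlinarith
      -- Below degree 4n the relators impose no condition, as b(0) = 0.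
      · have h1 := h s 0 (by omega)
        rw [h0] at h1
        omega
  induction s with
  | zero => simp
  | succ s ih => have := key s; omega

/-- The normal closure of `n` elements which act trivially on polynomial functions of degree at
most `4 * n` has infinite index in a free group of rank two. -/
lemma not_finiteIndex_normalClosure {n : ℕ} (r : Fin n → FreeGroup (Fin 2))
    (hr : ∀ i, ∀ f ∈ polyFun (ZMod 2) (FreeGroup (Fin 2)) (4 * n + 1),
      rightTranslate (ZMod 2) (r i) f = f) :
    ¬ (Subgroup.normalClosure (Set.range r)).FiniteIndex := by
  intro hfin
  have h := le_of_golodShafarevich_recursion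
    (b := fun s => Module.finrank (ZMod 2)
      (polyInvFun (ZMod 2) (Subgroup.normalClosure (Set.range r)) s)) (n := n)
    (finrank_polyInvFun_zero _)
    (fun s t hst => by simpa using finrank_polyInvFun_succ r hr s t hst)
    ((Subgroup.normalClosure (Set.range r)).index + 1)
  have h' := finrank_polyInvFun_le_index (k := ZMod 2) (Subgroup.normalClosure (Set.range r))
    ((Subgroup.normalClosure (Set.range r)).index + 1)
  omega

/-! ### Comparing surjections onto the free group -/

/-- If `s` is a section of `f`, then the kernel of `f` is the normal closure of the elements
`x⁻¹ * s (f x)` with `x` running over a generating family. -/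
lemma ker_le_normalClosure_of_section {H F ι : Type*} [Group H] [Group F] {x : ι → H}
    (hx : Subgroup.closure (Set.range x) = ⊤) (f : H →* F) (s : F →* H) :
    f.ker ≤ Subgroup.normalClosure (Set.range fun i => (x i)⁻¹ * s (f (x i))) := by
  set M := Subgroup.normalClosure (Set.range fun i => (x i)⁻¹ * s (f (x i)))
  have h : QuotientGroup.mk' M = (QuotientGroup.mk' M).comp (s.comp f) := by
    refine MonoidHom.eq_of_eqOn_dense hx ?_
    rintro _ ⟨i, rfl⟩
    exact QuotientGroup.eq.2 (Subgroup.subset_normalClosure ⟨i, rfl⟩)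
  intro y hy
  rw [← QuotientGroup.eq_one_iff]
  have := DFunLike.congr_fun h y
  simpa [MonoidHom.mem_ker.1 hy] using this

/-- The action of the free group of rank two on its polynomial functions modulo `2`. -/
def polyAction (d : ℕ) (g : FreeGroup (Fin 2)) :
    polyFun (ZMod 2) (FreeGroup (Fin 2)) d → polyFun (ZMod 2) (FreeGroup (Fin 2)) d :=
  fun f => ⟨rightTranslate (ZMod 2) g f, rightTranslate_mem_polyFun f.2 g⟩

/-- The kernel of the action of `G` on polynomial functions of degree less than `d`. -/
def polyKer (k : Type*) [Field k] (G : Type*) [Group G] (d : ℕ) : Subgroup G where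
  carrier := {r | ∀ f ∈ polyFun k G d, rightTranslate k r f = f}
  one_mem' := by simp
  mul_mem' {x y} hx hy f hf := by rw [rightTranslate_mul, hy f hf, hx f hf]
  inv_mem' {x} hx f hf := by
    conv_lhs => rw [← hx f hf, ← rightTranslate_mul]
    simp

instance (k : Type*) [Field k] (G : Type*) [Group G] (d : ℕ) : (polyKer k G d).Normal where
  conj_mem r hr g f hf := by
    rw [mul_assoc, rightTranslate_mul, rightTranslate_mul,
      hr _ (rightTranslate_mem_polyFun hf g⁻¹), ← rightTranslate_mul]
    simp

lemma Primrec.nat_pow_right : Primrec₂ fun a b : ℕ => a ^ b := by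
  refine (Primrec.nat_rec' (f := fun p : ℕ × ℕ => p.2) (g := fun _ => 1)
    (h := fun p q => q.2 * p.1) Primrec.snd (Primrec.const 1)
    (Primrec.nat_mul.comp (Primrec.snd.comp Primrec.snd)
      (Primrec.fst.comp Primrec.fst))).of_eq ?_
  rintro ⟨a, b⟩
  induction b with
  | zero => rfl
  | succ b ih => simp only [pow_succ] at ih ⊢; rw [← ih]

lemma injective_polyAction_comp {n m : ℕ} {H : Type*} [Group H] {x : Fin n → H}
    (hx : Subgroup.closure (Set.range x) = ⊤) (f : Fin m → H →* FreeGroup (Fin 2))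
    (hf : ∀ i, Function.Surjective (f i))
    (hfin : ∀ i j, i < j → ((f i).ker ⊔ (f j).ker).FiniteIndex) :
    Function.Injective fun i l => polyAction (4 * n + 1) (f i (x l)) := by
  set K := polyKer (ZMod 2) (FreeGroup (Fin 2)) (4 * n + 1)
  have key : ∀ i j, i < j →
      (fun l => polyAction (4 * n + 1) (f i (x l))) ≠
        fun l => polyAction (4 * n + 1) (f j (x l)) := by
    intro i j hij h
    have hcomp : (QuotientGroup.mk' K).comp (f i) = (QuotientGroup.mk' K).comp (f j) := by
      refine MonoidHom.eq_of_eqOn_dense hx ?_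
      rintro _ ⟨l, rfl⟩
      refine QuotientGroup.eq.2 fun p hp => ?_
      have h1 : rightTranslate (ZMod 2) (f i (x l)) p = rightTranslate (ZMod 2) (f j (x l)) p :=
        congrArg Subtype.val (congrFun (congrFun h l) ⟨p, hp⟩)
      rw [rightTranslate_mul, ← h1, ← rightTranslate_mul]
      simp
    let s : FreeGroup (Fin 2) →* H :=
      FreeGroup.lift fun a => Function.surjInv (hf j) (FreeGroup.of a)
    have hs : ∀ w, f j (s w) = w := by
      have : (f j).comp s = MonoidHom.id _ := by
        ext a
        simp [s, Function.surjInv_eq]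
      exact fun w => DFunLike.congr_fun this w
    let y : Fin n → H := fun l => (x l)⁻¹ * s (f j (x l))
    -- Modulo K, f_i may be replaced by f_j, which kills y_l.
    have hy : ∀ l, f i (y l) ∈ K := by
      intro l
      have h1 := DFunLike.congr_fun hcomp (y l)
      simp only [MonoidHom.comp_apply, QuotientGroup.mk'_apply] at h1
      rw [← QuotientGroup.eq_one_iff, h1]
      simp [y, hs]
    refine not_finiteIndex_normalClosure (fun l => f i (y l)) hy ?_
    have hle : (f j).ker.map (f i) ≤ Subgroup.normalClosure (Set.range fun l => f i (y l)) := by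
      have h1 := Subgroup.map_mono (f := f i) (ker_le_normalClosure_of_section hx (f j) s)
      rwa [Subgroup.map_normalClosure _ _ (hf i), ← Set.range_comp] at h1
    have : ((f j).ker.map (f i)).FiniteIndex := by
      refine ⟨?_⟩
      rw [Subgroup.index_map, MonoidHom.range_eq_top.2 (hf i), Subgroup.index_top, mul_one,
        sup_comm]
      exact (hfin i j hij).index_ne_zero
    exact Subgroup.finiteIndex_of_le hle
  intro i j h
  rcases lt_trichotomy i j with hij | hij | hij
  · exact absurd h (key i j hij)
  · exact hij
  · exact absurd h.symm (key j i hij)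

theorem proposition3p3 :
    ∃ γ : ℕ → ℕ, Computable γ ∧
      ∀ (n m : ℕ) (H : Type*) [Group H] (N : Fin m → Subgroup H) [∀ i, (N i).Normal],
        (∃ x : Fin n → H, Subgroup.closure (Set.range x) = ⊤) →
        (∀ i, ∃ f : H ⧸ N i →* FreeGroup (Fin 2), Function.Surjective f) →
        (∀ i j, i < j → (N i ⊔ N j).FiniteIndex) →
        m ≤ γ n := by
  -- With Q = 2^(2^(4n+1)) bounding the number of polynomial functions, this is (Q^Q)^n: n-tuples of
  -- self-maps of a set of size Q.
  refine ⟨fun n => ((2 ^ 2 ^ (4 * n + 1)) ^ (2 ^ 2 ^ (4 * n + 1))) ^ n, ?_, ?_⟩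
  · have hpow := Primrec.nat_pow_right
    have h1 : Primrec fun n : ℕ => 2 ^ 2 ^ (4 * n + 1) :=
      hpow.comp (Primrec.const 2) (hpow.comp (Primrec.const 2)
        (Primrec.succ.comp (Primrec.nat_mul.comp (Primrec.const 4) Primrec.id)))
    exact (hpow.comp (hpow.comp h1 h1) Primrec.id).to_comp
  intro n m H _ N _ ⟨x, hx⟩ hf hfin
  choose f hf using hf
  have hker : ∀ i, N i ≤ ((f i).comp (QuotientGroup.mk' (N i))).ker := by
    intro i y hy
    simp [MonoidHom.mem_ker, (QuotientGroup.eq_one_iff y).2 hy]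
  have hinj := injective_polyAction_comp hx (fun i => (f i).comp (QuotientGroup.mk' (N i)))
    (fun i => (hf i).comp (QuotientGroup.mk'_surjective _)) fun i j hij => by
      have := hfin i j hij
      exact Subgroup.finiteIndex_of_le (sup_le_sup (hker i) (hker j))
  have := finite_polyFun (k := ZMod 2) (α := Fin 2) (4 * n + 1)
  have hcard := Nat.card_le_card_of_injective _ hinj
  rw [Nat.card_fun, Nat.card_fun] at hcard
  simp only [Nat.card_eq_fintype_card (α := Fin _), Fintype.card_fin] at hcard
  refine hcard.trans (Nat.pow_le_pow_left ?_ n)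
  have hc := card_polyFun_le (4 * n + 1)
  exact (Nat.pow_le_pow_left hc _).trans (Nat.pow_le_pow_right (by positivity) hc)
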